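/- All graphs are finite and simple, and $d_G$ denotes the shortest-path distance in a connected graph $G$. A vertex $w$ strongly resolves two distinct vertices $u,v$ of $G$ if $v$ lies on some shortest $u$–$w$ path or $u$ lies on some shortest $v$–$w$ path; the strong metric dimension $\dim_s(G)$ is the smallest cardinality of a set $S$ of vertices such that every two distinct vertices of $G$ are strongly resolved by some vertex of $S$. Vertices $u,v$ of $G$ are mutually maximally distant if $d_G(v,w)\le d_G(u,v)$ for every neighbour $w$ of $u$ and $d_G(u,w)\le d_G(u,v)$ for every neighbour $w$ of $v$. The boundary $\partial(G)$ is the set of vertices $u$ for which there is a vertex $v$ such that $u,v$ are mutually maximally distant, and the strong resolving graph $G_{SR}$ is the graph with vertex set $\partial(G)$ in which two distinct vertices are adjacent if and only if they are mutually maximally distant in $G$. A graph is vertex-transitive if its automorphism group acts transitively on its vertices. $G\,\square\,H$ denotes the Cartesian product: $(a,b)$ and $(c,d)$ are adjacent if and only if either $a=c$ and $bd\in E(H)$, or $b=d$ and $ac\in E(G)$. **Theorem.** Let $G$ and $H$ be two connected graphs, each with at least two vertices, such that $G_{SR}$ and $H_{SR}$ are vertex-transitive. Then $$\dim_s(G\,\square\,H)=\min\{|\partial(G)|\,\dim_s(H),\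 |\partial(H)|\,\dim_s(G)\}.$$ -/

import Mathlib

namespace SimpleGraph

variable {V : Type*} (G : SimpleGraph V)

/-- The interval `I_G[u, v]`: all vertices lying on some shortest `u`-`v` path
(a walk whose length is the distance is automatically a path). -/
def geodesicInterval (u v : V) : Set V :=
  {x | ∃ p : G.Walk u v, p.length = G.dist u v ∧ x ∈ p.support}

/-- The vertex `w` strongly resolves the vertices `u` and `v`. -/
def StronglyResolves (w u v : V) : Prop :=
  v ∈ G.geodesicInterval u w ∨ u ∈ G.geodesicInterval v w

/-- Every two (distinct) vertices are strongly resolved by some vertex of `S`. -/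
def IsStrongResolvingSet (S : Set V) : Prop :=
  ∀ u v : V, u ≠ v → ∃ w ∈ S, G.StronglyResolves w u v

/-- The strong metric dimension: the least cardinality of a strong resolving set.
For a finite connected graph the set of all vertices is strong resolving, so the minimum exists. -/
noncomputable def strongMetricDim : ℕ :=
  sInf {n : ℕ | ∃ S : Finset V, G.IsStrongResolvingSet (S : Set V) ∧ S.card = n}

/-- `u` is maximally distant from `v`. -/
def MaximallyDistant (u v : V) : Prop :=
  ∀ w : V, G.Adj u w → G.dist v w ≤ G.dist u v

/-- `u` and `v` are mutually maximally distant. -/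
def MutuallyMaximallyDistant (u v : V) : Prop :=
  G.MaximallyDistant u v ∧ G.MaximallyDistant v u

/-- The boundary `∂(G)`. -/
def boundary : Set V :=
  {u | ∃ v : V, G.MutuallyMaximallyDistant u v}

/-- The strong resolving graph, with vertex set `∂(G)`. The clause `u ≠ v` only makes explicit
that the graph has no loops: in a connected graph with at least two vertices no vertex is
mutually maximally distant from itself. -/
def strongResolvingGraph : SimpleGraph G.boundary where
  Adj u v := u ≠ v ∧ G.MutuallyMaximallyDistant (u : V) (v : V)
  symm := ⟨fun _ _ h => ⟨h.1.symm, h.2.2, h.2.1⟩⟩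
  loopless := ⟨fun _ h => h.1 rfl⟩

/-- The automorphism group acts transitively on the vertices. -/
def IsVertexTransitive : Prop :=
  ∀ u v : V, ∃ f : G ≃g G, f u = v

end SimpleGraph

/-!
A strong resolving set is the same thing as a set of vertices meeting every mutually maximally
distant pair (`isStrongResolvingSet_iff`): a geodesic cannot be continued past a maximally distant
vertex, so such a pair is resolved only by its own members, while every geodesic can be extended
at both ends until its endpoints are mutually maximally distant. A least such set is a minimum
vertex cover of the strong resolving graph, so that `dim_s(G) + α(G_SR) = |∂(G)|`
(`strongMetricDim_add_indepNum`), where `α` is the independence number. Distances in a Cartesian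
product add up coordinatewise, so mutual maximal distance in `G □ H` is mutual maximal distance in
both coordinates; hence the strong resolving graph of `G □ H` is the tensor product of those of
`G` and `H` (`strongResolvingGraphBoxProdIso`). The formula thus reduces to
`α(A × B) = max (α(A) |B|) (α(B) |A|)` for vertex-transitive graphs `A` and `B`
(`indepNum_tensorProd`).

The upper bound in that identity rests on a local density bound (`IsIndepSet.card_mul_card_le`):
an independent set `J` of a vertex-transitive graph `A` satisfies `|J| |A| ≤ α(A) |N[J]|`. Given an
independent set `S` of `A × B`, let `P` consist of the `(a, b) ∈ S` such that `b` is isolated in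
the fibre `S_a ⊆ B`, and let `Q` be the rest of `S`. Independence of `S` forces `a` to be isolated
in the fibre `S^b ⊆ A` for every `(a, b) ∈ Q`. So the fibres of `P` over `A` and those of `Q` over
`B` are independent, and moreover their fibrewise closed neighbourhoods are disjoint in `A × B`.
Adding up the density bounds over all fibres gives the claim.
-/

namespace SimpleGraph

/-! ### Independent sets in vertex-transitive graphs -/

open Classical in
/-- The closed neighbourhood `N[J]` of a finite set `J` of vertices. -/
noncomputable def closedNbhd {α : Type*} [Fintype α] (A : SimpleGraph α) (J : Finset α) :
    Finset α :=
  {x | ∃ j ∈ J, x = j ∨ A.Adj j x}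

open Classical in
/-- In a vertex-transitive graph, an independent set has density at most `α(A) / |A|` in its closed
neighbourhood. Indeed, a maximum independent set and all its images under automorphisms meet `N[J]`
in at least `|J|` vertices, and on average these intersections have `α(A) |N[J]| / |A|` vertices. -/
theorem IsIndepSet.card_mul_card_le {α : Type*} [Fintype α] {A : SimpleGraph α}
    (hA : A.IsVertexTransitive) {J : Finset α} (hJ : A.IsIndepSet (J : Set α)) :
    J.card * Fintype.card α ≤ A.indepNum * (A.closedNbhd J).card := by
  obtain ⟨I, hI⟩ := A.exists_isNIndepSet_indepNum
  have : Finite (A ≃g A) := DFunLike.finite _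
  have : Fintype (A ≃g A) := Fintype.ofFinite _
  set N := A.closedNbhd J with hN
  -- replacing the part of `f(I)` inside `N[J]` by `J` keeps `f(I)` independent
  have key (f : A ≃g A) : J.card ≤ ({x ∈ I | f x ∈ N} : Finset α).card := by
    have hind : A.IsIndepSet
        (((({x ∈ I | f x ∉ N} : Finset α).map f.toEquiv.toEmbedding) ∪ J : Finset α) : Set α) := by
      have h1 : ∀ x ∈ I, ∀ y ∈ I, ¬ A.Adj (f x) (f y) := by
        intro x hx y hy h
        have h' := f.map_adj_iff.1 h
        exact hI.isIndepSet hx hy h'.ne h'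
      have h2 : ∀ x, x ∉ N → ∀ j ∈ J, ¬ A.Adj j x := by
        intro x hx j hj h
        exact hx (by simp only [hN, closedNbhd, Finset.mem_filter_univ]; exact ⟨j, hj, .inr h⟩)
      have h3 : ∀ x ∈ J, ∀ y ∈ J, ¬ A.Adj x y := fun x hx y hy h => hJ hx hy h.ne h
      intro x hx y hy _ hadj
      simp only [Finset.coe_union, Finset.coe_map, Set.mem_union, Set.mem_image, Finset.mem_coe,
        Finset.mem_filter] at hx hy
      rcases hx with ⟨x, ⟨hx, hx'⟩, rfl⟩ | hx <;> rcases hy with ⟨y, ⟨hy, hy'⟩, rfl⟩ | hy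
      · exact h1 x hx y hy hadj
      · exact h2 _ hx' _ hy hadj.symm
      · exact h2 _ hy' _ hx hadj
      · exact h3 x hx y hy hadj
    have hdisj : Disjoint (({x ∈ I | f x ∉ N} : Finset α).map f.toEquiv.toEmbedding) J := by
      rw [Finset.disjoint_left]
      intro x hx hxJ
      obtain ⟨y, hy, rfl⟩ := Finset.mem_map.1 hx
      refine (Finset.mem_filter.1 hy).2 ?_
      simp only [hN, closedNbhd, Finset.mem_filter_univ]
      exact ⟨_, hxJ, .inl rfl⟩
    have hle := hind.card_le_indepNum
    rw [Finset.card_union_of_disjoint hdisj, Finset.card_map, ← hI.card_eq] at hle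
    have := Finset.card_filter_add_card_filter_not (s := I) (fun x => f x ∈ N)
    omega
  -- by transitivity, equally many automorphisms carry `x` to each vertex `y`
  have fib (x y : α) : Fintype.card (A ≃g A) =
      Fintype.card α * ({f | f x = y} : Finset (A ≃g A)).card := by
    have hc : ∀ z ∈ (Finset.univ : Finset α),
        ({f | f x = z} : Finset (A ≃g A)).card = ({f | f x = y} : Finset (A ≃g A)).card := by
      intro z _
      obtain ⟨g, hg⟩ := hA z y
      refine Finset.card_bij' (fun f _ => f.trans g) (fun f _ => f.trans g.symm) ?_ ?_ ?_ ?_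
      · intro f hf; simp_all
      · intro f hf
        simp only [Finset.mem_filter_univ] at hf ⊢
        simp [hf, ← hg]
      · intro f _; ext; simp
      · intro f _; ext; simp
    have := Finset.card_eq_sum_card_fiberwise (s := (Finset.univ : Finset (A ≃g A)))
      (t := (Finset.univ : Finset α)) (f := fun f => f x)
      (fun _ _ => Finset.mem_coe.2 (Finset.mem_univ _))
    rw [Finset.sum_congr rfl hc] at this
    simpa using this
  have hsum : ∑ f : A ≃g A, ({x ∈ I | f x ∈ N} : Finset α).card =
      ∑ x ∈ I, ∑ y ∈ N, ({f | f x = y} : Finset (A ≃g A)).card := by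
    simp only [Finset.card_filter]
    rw [Finset.sum_comm]
    refine Finset.sum_congr rfl fun x _ => ?_
    rw [Finset.sum_comm]
    refine Finset.sum_congr rfl fun f _ => ?_
    simp
  have hpos : 0 < Fintype.card (A ≃g A) := Fintype.card_pos_iff.2 ⟨RelIso.refl _⟩
  -- double counting of the pairs `(f, x)` with `x ∈ I` and `f x ∈ N[J]`
  refine Nat.le_of_mul_le_mul_right ?_ hpos
  calc J.card * Fintype.card α * Fintype.card (A ≃g A)
      = Fintype.card α * ∑ f : A ≃g A, J.card := by simp; ring
    _ ≤ Fintype.card α * ∑ f : A ≃g A, ({x ∈ I | f x ∈ N} : Finset α).card := by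
        exact Nat.mul_le_mul_left _ (Finset.sum_le_sum fun f _ => key f)
    _ = A.indepNum * N.card * Fintype.card (A ≃g A) := by
        simp only [hsum, Finset.mul_sum, ← fib, Finset.sum_const, smul_eq_mul, hI.card_eq]
        ring

/-! ### Independent sets in tensor products -/

/-- The tensor (direct, categorical) product of two graphs. -/
def tensorProd {α β : Type*} (A : SimpleGraph α) (B : SimpleGraph β) : SimpleGraph (α × β) where
  Adj x y := A.Adj x.1 y.1 ∧ B.Adj x.2 y.2
  symm := ⟨fun _ _ h => ⟨h.1.symm, h.2.symm⟩⟩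
  loopless := ⟨fun _ h => h.1.ne rfl⟩

open Classical in
theorem indepNum_tensorProd_le {α β : Type*} [Fintype α] [Fintype β] {A : SimpleGraph α}
    {B : SimpleGraph β} (hA : A.IsVertexTransitive) (hB : B.IsVertexTransitive) :
    (A.tensorProd B).indepNum ≤
      max (A.indepNum * Fintype.card β) (B.indepNum * Fintype.card α) := by
  obtain ⟨S, hS⟩ := (A.tensorProd B).exists_isNIndepSet_indepNum
  have hno : ∀ {a a' b b'}, (a, b) ∈ S → (a', b') ∈ S → A.Adj a a' → B.Adj b b' → False :=
    fun {a a' b b'} h h' ha hb => hS.isIndepSet h h' (fun e => ha.ne (Prod.ext_iff.1 e).1) ⟨ha, hb⟩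
  -- the vertices of `S` whose second coordinate is isolated in their fibre `S_a ⊆ B`
  let P : Finset (α × β) := {x ∈ S | ∀ b, (x.1, b) ∈ S → ¬ B.Adj x.2 b}
  let Q : Finset (α × β) := {x ∈ S | ¬ ∀ b, (x.1, b) ∈ S → ¬ B.Adj x.2 b}
  have hP {a b} : (a, b) ∈ P ↔ (a, b) ∈ S ∧ ∀ b', (a, b') ∈ S → ¬ B.Adj b b' := by simp [P]
  have hPQ : P.card + Q.card = S.card := Finset.card_filter_add_card_filter_not _
  have hPQ' : Disjoint P Q := Finset.disjoint_filter_filter_not _ _ _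
  have hQS {x} (h : x ∈ Q) : x ∈ S := (Finset.mem_filter.1 h).1
  -- if `a` had a neighbour `a'` in `S^b`, then, as `b` has a neighbour `b'` in `S_a`, the vertices
  -- `(a', b)` and `(a, b')` of `S` would be adjacent
  have hQ {a b} (h : (a, b) ∈ Q) : ∀ a', (a', b) ∈ S → ¬ A.Adj a a' := by
    intro a' ha' hadj
    have h' := (Finset.mem_filter.1 h).2
    push Not at h'
    obtain ⟨b', hb', hbb'⟩ := h'
    exact hno ha' hb' hadj.symm hbb'
  let p (a : α) : Finset β := {b | (a, b) ∈ P}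
  let q (b : β) : Finset α := {a | (a, b) ∈ Q}
  have hpi (a : α) : B.IsIndepSet (p a : Set β) := by
    intro b hb b' hb' _
    simp only [p, Finset.coe_filter, Finset.mem_univ, true_and, Set.mem_ofPred_eq, hP] at hb hb'
    exact hb.2 b' hb'.1
  have hqi (b : β) : A.IsIndepSet (q b : Set α) := by
    intro a ha a' ha' _
    simp only [q, Finset.coe_filter, Finset.mem_univ, true_and, Set.mem_ofPred_eq] at ha ha'
    exact hQ ha a' (hQS ha')
  let X : Finset (α × β) := {x | x.2 ∈ B.closedNbhd (p x.1)}
  let Y : Finset (α × β) := {x | x.1 ∈ A.closedNbhd (q x.2)}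
  have hXY : Disjoint X Y := by
    rw [Finset.disjoint_left]
    rintro ⟨a, b⟩ hX hY
    simp only [X, Y, p, q, closedNbhd, Finset.mem_filter_univ] at hX hY
    obtain ⟨b', hb', e⟩ := hX
    obtain ⟨a', ha', e'⟩ := hY
    rcases e with rfl | e <;> rcases e' with rfl | e'
    · exact Finset.disjoint_left.1 hPQ' hb' ha'
    · exact hQ ha' a (hP.1 hb').1 e'
    · exact (hP.1 hb').2 b (hQS ha') e
    · exact hno (hP.1 hb').1 (hQS ha') e'.symm e
  have hcard : X.card + Y.card ≤ Fintype.card α * Fintype.card β := by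
    rw [← Finset.card_union_of_disjoint hXY, ← Fintype.card_prod]
    exact Finset.card_le_univ _
  have sum1 (T : Finset (α × β)) :
      T.card = ∑ a, ({b | (a, b) ∈ T} : Finset β).card := by
    simp only [Finset.card_filter]
    rw [← Fintype.sum_prod_type' (f := fun a b => if (a, b) ∈ T then 1 else 0)]
    simp
  have sum2 (T : Finset (α × β)) :
      T.card = ∑ b, ({a | (a, b) ∈ T} : Finset α).card := by
    simp only [Finset.card_filter]
    rw [← Fintype.sum_prod_type_right' (f := fun a b => if (a, b) ∈ T then 1 else 0)]
    simp
  have hPX : P.card * Fintype.card β ≤ B.indepNum * X.card := by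
    rw [sum1 P, sum1 X, Finset.sum_mul, Finset.mul_sum]
    refine Finset.sum_le_sum fun a _ => ?_
    simpa [X] using (hpi a).card_mul_card_le hB
  have hQY : Q.card * Fintype.card α ≤ A.indepNum * Y.card := by
    rw [sum2 Q, sum2 Y, Finset.sum_mul, Finset.mul_sum]
    refine Finset.sum_le_sum fun b _ => ?_
    simpa [Y] using (hqi b).card_mul_card_le hA
  rw [← hS.card_eq, ← hPQ]
  rcases isEmpty_or_nonempty α with _ | _
  · simp [Finset.eq_empty_of_isEmpty]
  rcases isEmpty_or_nonempty β with _ | _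
  · simp [Finset.eq_empty_of_isEmpty]
  have ha : 0 < Fintype.card α := Fintype.card_pos
  have hb : 0 < Fintype.card β := Fintype.card_pos
  set M := max (A.indepNum * Fintype.card β) (B.indepNum * Fintype.card α)
  refine Nat.le_of_mul_le_mul_right ?_ (Nat.mul_pos ha hb)
  calc (P.card + Q.card) * (Fintype.card α * Fintype.card β)
      = P.card * Fintype.card β * Fintype.card α + Q.card * Fintype.card α * Fintype.card β := by
        ring
    _ ≤ B.indepNum * X.card * Fintype.card α + A.indepNum * Y.card * Fintype.card β := by gcongr
    _ = B.indepNum * Fintype.card α * X.card + A.indepNum * Fintype.card β * Y.card := by ring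
    _ ≤ M * X.card + M * Y.card := by
        gcongr
        · exact le_max_right _ _
        · exact le_max_left _ _
    _ = M * (X.card + Y.card) := by ring
    _ ≤ M * (Fintype.card α * Fintype.card β) := by gcongr

/-- The lower bound is attained by `I × β` and `α × I` with `I` a maximum independent set of the
respective factor. -/
theorem indepNum_tensorProd {α β : Type*} [Finite α] [Finite β] {A : SimpleGraph α}
    {B : SimpleGraph β} (hA : A.IsVertexTransitive) (hB : B.IsVertexTransitive) :
    (A.tensorProd B).indepNum =
      max (A.indepNum * Nat.card β) (B.indepNum * Nat.card α) := by
  have := Fintype.ofFinite α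
  have := Fintype.ofFinite β
  rw [Nat.card_eq_fintype_card, Nat.card_eq_fintype_card]
  refine le_antisymm (indepNum_tensorProd_le hA hB) (max_le ?_ ?_)
  · obtain ⟨I, hI⟩ := A.exists_isNIndepSet_indepNum
    rw [← hI.card_eq, ← Finset.card_univ, ← Finset.card_product]
    refine IsIndepSet.card_le_indepNum fun x hx y hy _ h => ?_
    simp only [Finset.coe_product, Set.mem_prod, Finset.mem_coe] at hx hy
    exact hI.isIndepSet hx.1 hy.1 h.1.ne h.1
  · obtain ⟨I, hI⟩ := B.exists_isNIndepSet_indepNum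
    rw [← hI.card_eq, mul_comm, ← Finset.card_univ, ← Finset.card_product]
    refine IsIndepSet.card_le_indepNum fun x hx y hy _ h => ?_
    simp only [Finset.coe_product, Set.mem_prod, Finset.mem_coe] at hx hy
    exact hI.isIndepSet hx.2 hy.2 h.2.ne h.2

/-! ### Strong resolving sets and mutually maximally distant pairs -/

theorem Connected.mem_geodesicInterval {V : Type*} {G : SimpleGraph V} (hG : G.Connected)
    {u v x : V} : x ∈ G.geodesicInterval u v ↔ G.dist u x + G.dist x v = G.dist u v := by
  classical
  constructor
  · rintro ⟨p, hp, hx⟩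
    refine le_antisymm ?_ hG.dist_triangle
    rw [← hp, ← p.take_spec hx, Walk.length_append]
    exact Nat.add_le_add (dist_le _) (dist_le _)
  · intro h
    obtain ⟨p, hp⟩ := hG.exists_walk_length_eq_dist u x
    obtain ⟨q, hq⟩ := hG.exists_walk_length_eq_dist x v
    exact ⟨p.append q, by rw [Walk.length_append, hp, hq, h], by simp⟩

/-- A geodesic from `u` through `v` ends at `v` if `v` is maximally distant from `u`. -/
theorem MaximallyDistant.eq_of_mem_geodesicInterval {V : Type*} {G : SimpleGraph V}
    (hG : G.Connected) {u v w : V} (h : G.MaximallyDistant v u)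
    (hv : v ∈ G.geodesicInterval u w) : v = w := by
  rw [hG.mem_geodesicInterval] at hv
  by_contra hne
  obtain ⟨p, hp⟩ := hG.exists_walk_length_eq_dist v w
  cases p with
  | nil => exact hne rfl
  | @cons _ x _ hx p =>
    have h1 := h x hx
    have h2 := dist_le p
    have h3 := hG.dist_triangle (u := u) (v := x) (w := w)
    rw [Walk.length_cons] at hp
    rw [dist_comm (u := v) (v := u)] at h1
    omega

theorem MutuallyMaximallyDistant.ne {V : Type*} [Nontrivial V] {G : SimpleGraph V}
    (hG : G.Connected) {u v : V} (h : G.MutuallyMaximallyDistant u v) : u ≠ v := by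
  rintro rfl
  -- a neighbour of `u` is farther from `u` than `u` itself
  obtain ⟨w, hw⟩ := hG.preconnected.exists_adj_of_nontrivial u
  have := h.1 w hw
  rw [dist_eq_one_iff_adj.2 hw] at this
  simp at this

/-- A set is strong resolving if and only if it meets every mutually maximally distant pair:
such a pair is resolved by its own members only, and every geodesic extends to one between
mutually maximally distant vertices. -/
theorem isStrongResolvingSet_iff {V : Type*} [Finite V] [Nontrivial V] {G : SimpleGraph V}
    (hG : G.Connected) {S : Set V} :
    G.IsStrongResolvingSet S ↔ ∀ u v, G.MutuallyMaximallyDistant u v → u ∈ S ∨ v ∈ S := by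
  constructor
  · intro hS u v huv
    obtain ⟨w, hw, h | h⟩ := hS u v (huv.ne hG)
    · exact .inr (huv.2.eq_of_mem_geodesicInterval hG h ▸ hw)
    · exact .inl (huv.1.eq_of_mem_geodesicInterval hG h ▸ hw)
  · intro hS u v _
    -- a longest geodesic through `u` and then `v` has mutually maximally distant endpoints
    obtain ⟨⟨u', v'⟩, h, hmax⟩ := Set.exists_max_image
      {x : V × V | G.dist x.1 u + G.dist u v + G.dist v x.2 = G.dist x.1 x.2}
      (fun x => G.dist x.1 x.2) (Set.toFinite _) ⟨(u, v), by simp⟩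
    simp only [Set.mem_ofPred_eq, Prod.forall] at h hmax
    have h1 : G.MaximallyDistant u' v' := by
      intro w hw
      by_contra! hlt
      have e := dist_eq_one_iff_adj.2 hw
      have t1 := hG.dist_triangle (u := w) (v := u') (w := u)
      have t2 := hG.dist_triangle (u := w) (v := u) (w := v')
      have t3 := hG.dist_triangle (u := u) (v := v) (w := v')
      rw [dist_comm (u := w) (v := u')] at t1
      rw [dist_comm (u := v') (v := w)] at hlt
      have := hmax w v' (by omega)
      omega
    have h2 : G.MaximallyDistant v' u' := by
      intro w hw
      by_contra! hlt
      have e := dist_eq_one_iff_adj.2 hw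
      have t1 := hG.dist_triangle (u := v) (v := v') (w := w)
      have t2 := hG.dist_triangle (u := u') (v := v) (w := w)
      have t3 := hG.dist_triangle (u := u') (v := u) (w := v)
      rw [dist_comm (u := v') (v := u')] at hlt
      have := hmax u' w (by omega)
      omega
    have t1 := hG.dist_triangle (u := u') (v := u) (w := v)
    have t2 := hG.dist_triangle (u := u') (v := v) (w := v')
    have t3 := hG.dist_triangle (u := u) (v := v) (w := v')
    have t4 := hG.dist_triangle (u := u') (v := u) (w := v')
    rcases hS u' v' ⟨h1, h2⟩ with hm | hm
    · refine ⟨u', hm, .inr ?_⟩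
      rw [hG.mem_geodesicInterval, dist_comm (u := v), dist_comm (u := u) (v := u'),
        dist_comm (u := v) (v := u')]
      omega
    · refine ⟨v', hm, .inl ?_⟩
      rw [hG.mem_geodesicInterval]
      omega

/-- Within the boundary, the complements of strong resolving sets are the independent sets of the
strong resolving graph. -/
theorem strongMetricDim_add_indepNum {V : Type*} [Finite V] [Nontrivial V] {G : SimpleGraph V}
    (hG : G.Connected) :
    G.strongMetricDim + G.strongResolvingGraph.indepNum = G.boundary.ncard := by
  classical
  have := Fintype.ofFinite V
  have hcard : Fintype.card G.boundary = G.boundary.ncard := by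
    rw [← Nat.card_coe_set_eq, Nat.card_eq_fintype_card]
  refine le_antisymm ?_ ?_
  · obtain ⟨I, hI⟩ := G.strongResolvingGraph.exists_isNIndepSet_indepNum
    have hle : G.strongMetricDim ≤ (Iᶜ.map (Function.Embedding.subtype _)).card := by
      refine Nat.sInf_le ⟨_, ?_, rfl⟩
      rw [isStrongResolvingSet_iff hG]
      intro u v huv
      by_contra! hc
      let u' : G.boundary := ⟨u, v, huv⟩
      let v' : G.boundary := ⟨v, u, huv.2, huv.1⟩
      have hu : u' ∈ I := by
        by_contra hu; exact hc.1 (Finset.mem_coe.2 (Finset.mem_map.2 ⟨u', Finset.mem_compl.2 hu, rfl⟩))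
      have hv : v' ∈ I := by
        by_contra hv; exact hc.2 (Finset.mem_coe.2 (Finset.mem_map.2 ⟨v', Finset.mem_compl.2 hv, rfl⟩))
      have hne : u' ≠ v' := fun e => huv.ne hG (congrArg Subtype.val e)
      exact hI.isIndepSet hu hv hne ⟨hne, huv⟩
    rw [Finset.card_map, Finset.card_compl, hI.card_eq, hcard] at hle
    have := Finset.card_le_univ I
    rw [hI.card_eq, hcard] at this
    omega
  · obtain ⟨S, hS, hSc⟩ : G.strongMetricDim ∈
        {n : ℕ | ∃ S : Finset V, G.IsStrongResolvingSet (S : Set V) ∧ S.card = n} := by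
      refine Nat.sInf_mem ⟨_, Finset.univ, ?_, rfl⟩
      rw [isStrongResolvingSet_iff hG]
      simp
    rw [isStrongResolvingSet_iff hG] at hS
    let T : Finset G.boundary := {x | (x : V) ∈ S}
    have hT : T.card ≤ S.card :=
      Finset.card_le_card_of_injOn Subtype.val (by simp [T, Set.MapsTo])
        Subtype.val_injective.injOn
    have hi : Tᶜ.card ≤ G.strongResolvingGraph.indepNum := by
      refine IsIndepSet.card_le_indepNum fun x hx y hy _ hxy => ?_
      simp only [T, Finset.coe_compl, Set.mem_compl_iff, Finset.mem_coe, Finset.mem_filter_univ]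
        at hx hy
      exact (hS x y hxy.2).elim hx hy
    rw [Finset.card_compl, hcard] at hi
    omega

/-! ### Strong resolving graphs of Cartesian products -/

theorem Connected.dist_boxProd {V W : Type*} {G : SimpleGraph V} {H : SimpleGraph W}
    (hG : G.Connected) (hH : H.Connected) (x y : V × W) :
    (G □ H).dist x y = G.dist x.1 y.1 + H.dist x.2 y.2 := by
  have h := edist_boxProd (G := G) (H := H) x y
  rw [← ((hG.boxProd hH).preconnected x y).coe_dist_eq_edist,
    ← (hG.preconnected x.1 y.1).coe_dist_eq_edist,
    ← (hH.preconnected x.2 y.2).coe_dist_eq_edist] at h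
  exact_mod_cast h

theorem maximallyDistant_boxProd {V W : Type*} {G : SimpleGraph V} {H : SimpleGraph W}
    (hG : G.Connected) (hH : H.Connected) {x y : V × W} :
    (G □ H).MaximallyDistant x y ↔
      G.MaximallyDistant x.1 y.1 ∧ H.MaximallyDistant x.2 y.2 := by
  simp only [MaximallyDistant, hG.dist_boxProd hH, boxProd_adj, Prod.forall]
  constructor
  · intro h
    refine ⟨fun w hw => ?_, fun w hw => ?_⟩
    · have := h w x.2 (.inl ⟨hw, rfl⟩)
      rw [dist_comm (u := y.2)] at this
      omega
    · have := h x.1 w (.inr ⟨hw, rfl⟩)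
      rw [dist_comm (u := y.1)] at this
      omega
  · rintro ⟨h1, h2⟩ a b (⟨h, rfl⟩ | ⟨h, rfl⟩)
    · have := h1 a h
      rw [dist_comm (u := y.2)]
      omega
    · have := h2 b h
      rw [dist_comm (u := y.1)]
      omega

theorem mutuallyMaximallyDistant_boxProd {V W : Type*} {G : SimpleGraph V} {H : SimpleGraph W}
    (hG : G.Connected) (hH : H.Connected) {x y : V × W} :
    (G □ H).MutuallyMaximallyDistant x y ↔
      G.MutuallyMaximallyDistant x.1 y.1 ∧ H.MutuallyMaximallyDistant x.2 y.2 := by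
  simp only [MutuallyMaximallyDistant, maximallyDistant_boxProd hG hH]
  tauto

theorem boundary_boxProd {V W : Type*} {G : SimpleGraph V} {H : SimpleGraph W}
    (hG : G.Connected) (hH : H.Connected) :
    (G □ H).boundary = G.boundary ×ˢ H.boundary := by
  ext x
  simp [boundary, mutuallyMaximallyDistant_boxProd hG hH]

/-- The strong resolving graph of a Cartesian product is the tensor product of the strong
resolving graphs. -/
def strongResolvingGraphBoxProdIso {V W : Type*} [Nontrivial V] [Nontrivial W]
    {G : SimpleGraph V} {H : SimpleGraph W} (hG : G.Connected) (hH : H.Connected) :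
    (G □ H).strongResolvingGraph ≃g G.strongResolvingGraph.tensorProd H.strongResolvingGraph where
  toEquiv := (Equiv.setCongr (boundary_boxProd hG hH)).trans (Equiv.Set.prod _ _)
  map_rel_iff' := by
    rintro ⟨x, hx⟩ ⟨y, hy⟩
    simp only [strongResolvingGraph, tensorProd, mutuallyMaximallyDistant_boxProd hG hH]
    constructor
    · rintro ⟨⟨h1, h2⟩, -, h3⟩
      exact ⟨fun e => h1 (by cases e; rfl), h2, h3⟩
    · rintro ⟨-, h1, h2⟩
      exact ⟨⟨fun e => h1.ne hG (congrArg Subtype.val e), h1⟩,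
        fun e => h2.ne hH (congrArg Subtype.val e), h2⟩

theorem indepNum_le_of_iso {α β : Type*} [Finite β] {A : SimpleGraph α} {B : SimpleGraph β}
    (f : A ≃g B) : A.indepNum ≤ B.indepNum := by
  have : Finite α := Finite.of_equiv _ f.symm.toEquiv
  obtain ⟨I, hI⟩ := A.exists_isNIndepSet_indepNum
  rw [← hI.card_eq, ← Finset.card_map f.toEquiv.toEmbedding]
  refine IsIndepSet.card_le_indepNum ?_
  rintro _ hx' _ hy' - h
  obtain ⟨x, hx, rfl⟩ := Finset.mem_map.1 (Finset.mem_coe.1 hx')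
  obtain ⟨y, hy, rfl⟩ := Finset.mem_map.1 (Finset.mem_coe.1 hy')
  have h' := f.map_adj_iff.1 h
  exact hI.isIndepSet hx hy h'.ne h'

theorem indepNum_congr {α β : Type*} [Finite α] [Finite β] {A : SimpleGraph α}
    {B : SimpleGraph β} (f : A ≃g B) : A.indepNum = B.indepNum :=
  le_antisymm (indepNum_le_of_iso f) (indepNum_le_of_iso f.symm)

end SimpleGraph

theorem mainTheorem5 {V W : Type*} [Finite V] [Finite W] [Nontrivial V] [Nontrivial W]
    (G : SimpleGraph V) (H : SimpleGraph W) (hG : G.Connected) (hH : H.Connected)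
    (hGt : G.strongResolvingGraph.IsVertexTransitive)
    (hHt : H.strongResolvingGraph.IsVertexTransitive) :
    (G □ H).strongMetricDim =
      min (G.boundary.ncard * H.strongMetricDim) (H.boundary.ncard * G.strongMetricDim) := by
  have hα := (SimpleGraph.indepNum_congr
    (SimpleGraph.strongResolvingGraphBoxProdIso hG hH)).trans
      (SimpleGraph.indepNum_tensorProd hGt hHt)
  have hGH := SimpleGraph.strongMetricDim_add_indepNum (hG.boxProd hH)
  rw [hα, SimpleGraph.boundary_boxProd hG hH, Set.ncard_prod, Nat.card_coe_set_eq,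
    Nat.card_coe_set_eq] at hGH
  have h1 := SimpleGraph.strongMetricDim_add_indepNum hG
  have h2 := SimpleGraph.strongMetricDim_add_indepNum hH
  have e1 : G.boundary.ncard * H.strongMetricDim +
      H.strongResolvingGraph.indepNum * G.boundary.ncard =
        G.boundary.ncard * H.boundary.ncard := by rw [← h2]; ring
  have e2 : H.boundary.ncard * G.strongMetricDim +
      G.strongResolvingGraph.indepNum * H.boundary.ncard =
        G.boundary.ncard * H.boundary.ncard := by rw [← h1]; ring
  omega
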